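/- Let $\mathcal L$ be a first-order language expanding the language $(+,-,\cdot,0,1)$ of rings, let $R=(R,+,\cdot,0,1,\dots)$ be an $\mathcal L$-structure expanding a (not necessarily commutative) unital ring, let $\kappa>|R|+|\mathcal L|$ be a strong limit cardinal, and let $\bar R\succ R$ be a $\kappa$-saturated and strongly $\kappa$-homogeneous elementary extension, i.e. every finitely satisfiable set of formulas in one variable over fewer than $\kappa$ parameters is realized in $\bar R$, and every partial elementary map of $\bar R$ with domain of size less than $\kappa$ extends to an automorphism of $\bar R$. Let $A\subseteq\bar R$ with $|A|<\kappa$. A subset of $\bar R$ is $A$-type-definable if it is an intersection of $A$-definable sets, and $A$-invariant if it is preserved setwise by every automorphism of $\bar R$ fixing $A$ pointwise. A subgroup $H\le(\bar R,+)$ has bounded index if $|\bar R/H|<\kappa$; the index of a subring or ideal is that of its additive group. (1) Let $G\le(\bar R,+)$ be a subgroup of bounded index such that at least one of the subrings $\{r\in\bar R: rG\subseteq G\}$ and $\{r\in\bar R: Gr\subseteq G\}$ has bounded index. If $G$ is $A$-type-definable, then $G$ contains an $A$-type-definable two-sided ideal of $\bar R$ of bounded index. If $G$ is $A$-invariant,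 then $G$ contains an $A$-invariant two-sided ideal of $\bar R$ of bounded index. (2) Among the $A$-type-definable ideals of $\bar R$ of bounded index there exist a smallest left ideal, a smallest right ideal and a smallest two-sided ideal, and these three coincide. The same holds for the $A$-invariant ideals of $\bar R$ of bounded index. -/

import Mathlib

open Cardinal FirstOrder FirstOrder.Language

universe u v w w'

namespace RingComponents

section ModelTheory

variable (L : FirstOrder.Language.{u, v}) {M : Type w} [L.Structure M]

/-- `M` is `κ`-saturated: for every set `B` of fewer than `κ` parameters, every set of formulas
in one variable over `B` which is finitely satisfiable in `M` is realized in `M`. -/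
def IsSaturated (κ : Cardinal.{w}) (M : Type w) [L.Structure M] : Prop :=
  ∀ B : Set M, #B < κ → ∀ p : Set (L[[B]].Formula (Fin 1)),
    (∀ s : Finset (L[[B]].Formula (Fin 1)), (s : Set (L[[B]].Formula (Fin 1))) ⊆ p →
      ∃ x : Fin 1 → M, ∀ ψ ∈ s, ψ.Realize x) →
    ∃ x : Fin 1 → M, ∀ ψ ∈ p, ψ.Realize x

/-- `M` is strongly `κ`-homogeneous: every partial elementary map from a subset of `M` of
cardinality less than `κ` into `M` extends to an automorphism of `M`. -/
def IsStronglyHomogeneous (κ : Cardinal.{w}) (M : Type w) [L.Structure M] : Prop :=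
  ∀ B : Set M, #B < κ → ∀ f : B → M,
    (∀ ψ : L.Formula B, ψ.Realize (fun b : B => (b : M)) ↔ ψ.Realize f) →
    ∃ σ : M ≃[L] M, ∀ b : B, σ b = f b

/-- `X` is `A`-type-definable: it is the intersection of a family of `A`-definable subsets
of `M`. -/
def IsTypeDefinable (A X : Set M) : Prop :=
  ∃ D : Set (Set M), (∀ Y ∈ D, A.Definable₁ L Y) ∧ X = ⋂₀ D

/-- `X` is `A`-invariant: it is preserved setwise by all automorphisms of `M` that fix `A`
pointwise. -/
def IsInvariant (A X : Set M) : Prop :=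
  ∀ σ : M ≃[L] M, (∀ a ∈ A, σ a = a) → σ '' X = X

end ModelTheory

section Rings

variable {S : Type w} [Ring S]

/-- The subgroup `H` of `(S, +)` has bounded index: there are fewer than `κ` cosets of `H`. -/
def BoundedIndex (κ : Cardinal.{w}) (H : AddSubgroup S) : Prop :=
  #(S ⧸ H) < κ

/-- The setwise stabilizer of `G` under left multiplication: the subring of all `r` with
`r G ⊆ G`. -/
def leftStabilizer (G : AddSubgroup S) : Subring S where
  carrier := {r | ∀ x ∈ G, r * x ∈ G}
  mul_mem' := by
    intro a b ha hb x hx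
    rw [mul_assoc]
    exact ha _ (hb x hx)
  one_mem' := by
    intro x hx
    rwa [one_mul]
  add_mem' := by
    intro a b ha hb x hx
    rw [add_mul]
    exact G.add_mem (ha x hx) (hb x hx)
  zero_mem' := by
    intro x _
    rw [zero_mul]
    exact G.zero_mem
  neg_mem' := by
    intro a ha x hx
    rw [neg_mul]
    exact G.neg_mem (ha x hx)

/-- The setwise stabilizer of `G` under right multiplication: the subring of all `r` with
`G r ⊆ G`. -/
def rightStabilizer (G : AddSubgroup S) : Subring S where
  carrier := {r | ∀ x ∈ G, x * r ∈ G}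
  mul_mem' := by
    intro a b ha hb x hx
    rw [← mul_assoc]
    exact hb _ (ha x hx)
  one_mem' := by
    intro x hx
    rwa [mul_one]
  add_mem' := by
    intro a b ha hb x hx
    rw [mul_add]
    exact G.add_mem (ha x hx) (hb x hx)
  zero_mem' := by
    intro x _
    rw [mul_zero]
    exact G.zero_mem
  neg_mem' := by
    intro a ha x hx
    rw [mul_neg]
    exact G.neg_mem (ha x hx)

/-- The additive group of a two-sided ideal. -/
def twoSidedAddSubgroup (I : TwoSidedIdeal S) : AddSubgroup S :=
  Submodule.toAddSubgroup (TwoSidedIdeal.asIdeal I)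

theorem coe_twoSidedAddSubgroup (I : TwoSidedIdeal S) :
    (twoSidedAddSubgroup I : Set S) = (I : Set S) := by
  ext x
  simp [twoSidedAddSubgroup]

end Rings

end RingComponents

/-!
The largest two-sided ideal inside a subgroup `G` of `(S, +)` is its core
`{x | ∀ r s, r * x * s ∈ G}`. It is invariant if `G` is, and type-definable if `G` is, because the
core of a definable set is defined by quantifying over `r` and `s`. For its index, let the
subring `K` of bounded index satisfy `K G ⊆ G`. Whether `S x ⊆ G` holds for `x ∈ G` can be tested
on representatives of the cosets of `K`, so the left ideal `{x | S x ⊆ G}` has index at most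
`|S/G| * |S/G| ^ |S/K| < κ`. This left ideal is mapped into itself by right multiplication by its
own elements, and the same argument on the other side bounds the index of the core
(`boundedIndex_twoSidedCore`).

For the smallest ideals, the intersection of all invariant ideals of bounded index must again have
bounded index. Since `κ` may be singular, counting the ideals is not enough; a bound on the index
uniform in the ideals is needed. It comes from an elementary substructure of size less than `κ`
containing the parameters, over which elements of the same type are congruent modulo every
invariant subgroup of bounded index (`typeSetoid_le`). Hence the number of types over this
substructure bounds the index of the intersection (`exists_isLeast_ideals`). The substructure
exists if `κ` is uncountable and the ring has size at least `κ`. A ring of size less than `κ`, in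
particular the finite ring that arises for `κ = ℵ₀`, satisfies the bound trivially. The three
smallest ideals coincide because every one-sided ideal contains its core.
-/

namespace RingComponents

/-! ### Subgroups of bounded index -/

section BoundedIndexSubgroups

variable {S : Type w} [Ring S] {κ : Cardinal.{w}}

/-- A subgroup has bounded index once some map to a set of size less than `κ` separates its
cosets. -/
theorem boundedIndex_of_map {T : Type w} (hT : #T < κ) (f : S → T) {H : AddSubgroup S}
    (hf : ∀ x y, f x = f y → x - y ∈ H) : BoundedIndex κ H := by
  refine (mk_le_of_injective (f := fun q : S ⧸ H => f q.out) fun p q h => ?_).trans_lt hT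
  have := hf _ _ h.symm
  rw [← QuotientAddGroup.out_eq' p, ← QuotientAddGroup.out_eq' q]
  rwa [QuotientAddGroup.eq, neg_add_eq_sub]

theorem BoundedIndex.mono {H K : AddSubgroup S} (hH : BoundedIndex κ H) (h : H ≤ K) :
    BoundedIndex κ K :=
  boundedIndex_of_map hH (QuotientAddGroup.mk (s := H)) fun x y hxy => by
    rw [← neg_sub, neg_mem_iff, ← neg_add_eq_sub]
    exact h (QuotientAddGroup.eq.1 hxy)

theorem sub_out_mem (H : AddSubgroup S) (r : S) : r - ((r : S ⧸ H).out) ∈ H := by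
  rw [← neg_add_eq_sub, ← QuotientAddGroup.eq, QuotientAddGroup.out_eq']

theorem boundedIndex_top (hκ : κ.IsStrongLimit) : BoundedIndex κ (⊤ : AddSubgroup S) :=
  boundedIndex_of_map (T := PUnit) (by simpa using one_lt_aleph0.trans_le hκ.aleph0_le)
    (fun _ => PUnit.unit) fun _ _ _ => AddSubgroup.mem_top _

theorem power_lt_of_isStrongLimit (hκ : κ.IsStrongLimit) {a b : Cardinal.{w}} (ha : a < κ)
    (hb : b < κ) : a ^ b < κ :=
  calc a ^ b ≤ (2 ^ a) ^ b := power_le_power_right (cantor a).le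
    _ = 2 ^ (a * b) := (power_mul ..).symm
    _ < κ := hκ.isStrongPrelimit (mul_lt_of_lt hκ.aleph0_le ha hb)

/-- Let `B` be a biadditive action of `S` on itself and let `K` be a subgroup of bounded index
which maps `G` into itself. If `G` has bounded index then so does every subgroup `H` containing
those `x ∈ G` whose translates under all of `S` stay in `G`: by additivity it suffices to test
`x` against representatives of the cosets of `K`. -/
theorem boundedIndex_of_stabilizer (hκ : κ.IsStrongLimit) (B : S →+ S →+ S)
    {G K H : AddSubgroup S} (hG : BoundedIndex κ G) (hK : BoundedIndex κ K)
    (hKG : ∀ r ∈ K, ∀ x ∈ G, B r x ∈ G)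
    (hH : ∀ x ∈ G, (∀ r, B r x ∈ G) → x ∈ H) : BoundedIndex κ H := by
  refine boundedIndex_of_map (T := (S ⧸ G) × ((S ⧸ K) → (S ⧸ G))) ?_
    (fun x => (QuotientAddGroup.mk x, fun q => QuotientAddGroup.mk (B q.out x))) fun x y hxy => ?_
  · rw [mk_prod, lift_id, lift_id, ← power_def]
    exact mul_lt_of_lt hκ.aleph0_le hG (power_lt_of_isStrongLimit hκ hG hK)
  · obtain ⟨h₁, h₂⟩ := Prod.ext_iff.1 hxy
    have hG' : x - y ∈ G := by
      rw [← neg_add_eq_sub]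
      exact QuotientAddGroup.eq.1 h₁.symm
    refine hH _ hG' fun r => ?_
    have h₃ : B (r : S ⧸ K).out (x - y) ∈ G := by
      rw [map_sub, ← neg_add_eq_sub]
      exact QuotientAddGroup.eq.1 (congrFun h₂ (r : S ⧸ K)).symm
    have h₄ := G.add_mem (hKG _ (sub_out_mem K r) _ hG') h₃
    rwa [← AddMonoidHom.add_apply, ← map_add, sub_add_cancel] at h₄

end BoundedIndexSubgroups

/-! ### The largest two-sided ideal inside a subgroup -/

section TwoSidedCore

variable {S : Type w} [Ring S] {κ : Cardinal.{w}}

/-- The largest two-sided ideal of `S` contained in the subgroup `G` of `(S, +)`: the set of all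
`x` with `r x s ∈ G` for all `r` and `s`. -/
def twoSidedCore (G : AddSubgroup S) : TwoSidedIdeal S :=
  TwoSidedIdeal.mk' {x | ∀ r s, r * x * s ∈ G}
    (fun r s => by simp [G.zero_mem])
    (fun hx hy r s => by
      rw [mul_add, add_mul]
      exact G.add_mem (hx r s) (hy r s))
    (fun hx r s => by
      rw [mul_neg, neg_mul]
      exact G.neg_mem (hx r s))
    (fun {x y} hy r s => by
      rw [← mul_assoc]
      exact hy (r * x) s)
    (fun {x y} hx r s => by
      rw [← mul_assoc, mul_assoc]
      exact hx r (y * s))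

theorem mem_twoSidedCore {G : AddSubgroup S} {x : S} :
    x ∈ twoSidedCore G ↔ ∀ r s, r * x * s ∈ G :=
  TwoSidedIdeal.mem_mk' ..

theorem coe_twoSidedCore (G : AddSubgroup S) :
    (twoSidedCore G : Set S) = {x | ∀ r s, r * x * s ∈ (G : Set S)} :=
  Set.ext fun _ => mem_twoSidedCore

theorem twoSidedCore_subset (G : AddSubgroup S) : (twoSidedCore G : Set S) ⊆ G := fun x hx => by
  simpa using mem_twoSidedCore.1 hx 1 1

theorem mem_twoSidedAddSubgroup {I : TwoSidedIdeal S} {x : S} :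
    x ∈ twoSidedAddSubgroup I ↔ x ∈ I :=
  Set.ext_iff.1 (coe_twoSidedAddSubgroup I) x

/-- The passage from `G` to its core is made in two steps: a subgroup with bounded stabilizer on
one side is shrunk to a one-sided ideal `I`, and `I` is contained in its own stabilizer on the
other side, so that the same argument applies again. -/
theorem boundedIndex_twoSidedCore (hκ : κ.IsStrongLimit) {G : AddSubgroup S}
    (hG : BoundedIndex κ G)
    (hst : BoundedIndex κ (leftStabilizer G).toAddSubgroup ∨
      BoundedIndex κ (rightStabilizer G).toAddSubgroup) :
    BoundedIndex κ (twoSidedAddSubgroup (twoSidedCore G)) := by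
  rcases hst with hst | hst
  · let I : AddSubgroup S := ⨅ r, G.comap (AddMonoidHom.mulLeft r)
    have hI : ∀ {x}, x ∈ I ↔ ∀ r, r * x ∈ G := by simp [I, AddSubgroup.mem_iInf]
    have hIb : BoundedIndex κ I := boundedIndex_of_stabilizer hκ AddMonoidHom.mul hG hst
      (fun r hr x hx => hr x hx) fun x _ hx => hI.2 hx
    refine boundedIndex_of_stabilizer hκ AddMonoidHom.mul.flip hIb hIb
      (fun r hr x _ => hI.2 fun t => ?_) fun x _ hx => ?_
    · change t * (x * r) ∈ G
      rw [← mul_assoc]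
      exact hI.1 hr _
    · rw [mem_twoSidedAddSubgroup, mem_twoSidedCore]
      intro r s
      rw [mul_assoc]
      exact hI.1 (hx s) r
  · let I : AddSubgroup S := ⨅ r, G.comap (AddMonoidHom.mulRight r)
    have hI : ∀ {x}, x ∈ I ↔ ∀ r, x * r ∈ G := by simp [I, AddSubgroup.mem_iInf]
    have hIb : BoundedIndex κ I := boundedIndex_of_stabilizer hκ AddMonoidHom.mul.flip hG hst
      (fun r hr x hx => hr x hx) fun x _ hx => hI.2 hx
    refine boundedIndex_of_stabilizer hκ AddMonoidHom.mul hIb hIb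
      (fun r hr x _ => hI.2 fun t => ?_) fun x _ hx => ?_
    · change r * x * t ∈ G
      rw [mul_assoc]
      exact hI.1 hr _
    · rw [mem_twoSidedAddSubgroup, mem_twoSidedCore]
      intro r s
      exact hI.1 (hx r) s

/-- Existence and coincidence of the smallest left, right and two-sided ideals of bounded index
satisfying a property `P` of sets which passes to intersections and to cores. The equivalence
relation `e` with fewer than `κ` classes refines the cosets of every subgroup of bounded index
with `P`; it bounds the index of their intersection, whatever the number of these subgroups. -/
theorem exists_isLeast_ideals (hκ : κ.IsStrongLimit) (P : Set S → Prop)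
    (hinter : ∀ C : Set (Set S), (∀ Y ∈ C, P Y) → P (⋂₀ C))
    (hcore : ∀ Y, P Y → P {x | ∀ r s, r * x * s ∈ Y})
    (e : Setoid S) (he : #(Quotient e) < κ)
    (heP : ∀ H : AddSubgroup S, P (H : Set S) → BoundedIndex κ H → ∀ a b, e a b → a - b ∈ H) :
    ∃ (I : TwoSidedIdeal S) (Il : Ideal S) (Ir : Submodule Sᵐᵒᵖ S),
      IsLeast {J : TwoSidedIdeal S | P (J : Set S) ∧ BoundedIndex κ (twoSidedAddSubgroup J)} I ∧
      IsLeast {J : Ideal S | P (J : Set S) ∧ BoundedIndex κ J.toAddSubgroup} Il ∧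
      IsLeast {J : Submodule Sᵐᵒᵖ S | P (J : Set S) ∧ BoundedIndex κ J.toAddSubgroup} Ir ∧
      (Il : Set S) = (I : Set S) ∧ (Ir : Set S) = (I : Set S) := by
  -- `F` contains all left, right and two-sided ideals with `P` of bounded index, and the core of
  -- its intersection is the ideal sought.
  let F : Set (AddSubgroup S) := {H | P (H : Set S) ∧ BoundedIndex κ H ∧
    (BoundedIndex κ (leftStabilizer H).toAddSubgroup ∨
      BoundedIndex κ (rightStabilizer H).toAddSubgroup)}
  have hcoreF : ∀ H ∈ F, P (twoSidedCore H : Set S) ∧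
      BoundedIndex κ (twoSidedAddSubgroup (twoSidedCore H)) := fun H hH =>
    ⟨coe_twoSidedCore H ▸ hcore _ hH.1, boundedIndex_twoSidedCore hκ hH.2.1 hH.2.2⟩
  let I : TwoSidedIdeal S := twoSidedCore (sInf F)
  have hIF : ∀ H ∈ F, (I : Set S) ⊆ H := fun H hH =>
    (twoSidedCore_subset _).trans (sInf_le (a := H) hH :)
  have hP : P (I : Set S) := by
    rw [coe_twoSidedCore]
    refine hcore _ ?_
    rw [AddSubgroup.coe_sInf, ← Set.sInter_image]
    refine hinter _ ?_
    rintro _ ⟨H, hH, rfl⟩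
    exact hH.1
  have hb : BoundedIndex κ (twoSidedAddSubgroup I) := by
    refine boundedIndex_of_map he (fun x => (⟦x⟧ : Quotient e)) fun x y hxy => ?_
    rw [mem_twoSidedAddSubgroup, mem_twoSidedCore]
    intro r s
    refine AddSubgroup.mem_sInf.2 fun H hH => ?_
    have h := heP (twoSidedAddSubgroup (twoSidedCore H))
      ((coe_twoSidedAddSubgroup (twoSidedCore H)).symm ▸ (hcoreF H hH).1) (hcoreF H hH).2
      x y (Quotient.exact hxy)
    exact mem_twoSidedCore.1 (mem_twoSidedAddSubgroup.1 h) r s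
  let Il : Ideal S := TwoSidedIdeal.asIdeal I
  let Ir : Submodule Sᵐᵒᵖ S :=
    { carrier := I
      add_mem' := fun ha hb => I.add_mem ha hb
      zero_mem' := I.zero_mem
      smul_mem' := fun c x hx => I.mul_mem_right _ _ hx }
  have hIl : (Il : Set S) = I := Set.ext fun _ => TwoSidedIdeal.mem_asIdeal
  have hIr : (Ir : Set S) = I := rfl
  refine ⟨I, Il, Ir, ⟨⟨hP, hb⟩, fun J hJ => ?_⟩, ⟨⟨hIl ▸ hP, hb⟩, fun J hJ => ?_⟩,
    ⟨⟨hIr ▸ hP, ?_⟩, fun J hJ => ?_⟩, hIl, hIr⟩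
  · refine fun x hx => mem_twoSidedAddSubgroup.1 (hIF (twoSidedAddSubgroup J)
      ⟨(coe_twoSidedAddSubgroup J).symm ▸ hJ.1, hJ.2, Or.inl ?_⟩ hx)
    exact (boundedIndex_top hκ).mono fun r _ x hx => by
      rw [mem_twoSidedAddSubgroup] at hx ⊢
      exact J.mul_mem_left _ _ hx
  · refine fun x hx => hIF J.toAddSubgroup ⟨hJ.1, hJ.2, Or.inl ?_⟩ (hIl ▸ hx)
    exact (boundedIndex_top hκ).mono fun r _ x hx => J.mul_mem_left r hx
  · exact hb.mono fun x hx => mem_twoSidedAddSubgroup.1 hx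
  · refine fun x hx => hIF J.toAddSubgroup ⟨hJ.1, hJ.2, Or.inr ?_⟩ hx
    exact (boundedIndex_top hκ).mono fun r _ x hx => J.smul_mem (MulOpposite.op r) hx

end TwoSidedCore

/-! ### Types over small sets and bounded invariant equivalence relations -/

section Types

variable (L : FirstOrder.Language.{u, v}) {M : Type w} [L.Structure M]

/-- Two elements of `M` are equivalent if they have the same type over `B`, that is, satisfy the
same formulas in one variable with parameters from `B`. -/
def typeSetoid (B : Set M) : Setoid M :=
  Setoid.ker fun a => {χ : L[[B]].Formula (Fin 1) | χ.Realize fun _ => a}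

variable {L}

theorem typeSetoid_apply {B : Set M} {a b : M} : typeSetoid L B a b ↔
    ∀ χ : L[[B]].Formula (Fin 1), χ.Realize (fun _ => a) ↔ χ.Realize (fun _ => b) :=
  Set.ext_iff

/-- Substituting parameters for all but one of the variables of a formula gives a formula with
parameters. -/
theorem exists_formula_realize_iff {B : Set M} {α : Type w} (ψ : L.Formula α)
    (t : α → B ⊕ Fin 1) : ∃ χ : L[[B]].Formula (Fin 1), ∀ x : Fin 1 → M,
      χ.Realize x ↔ ψ.Realize fun i => Sum.elim (fun b : B => (b : M)) x (t i) := by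
  obtain ⟨χ, h⟩ : B.Definable L {x : Fin 1 → M |
      ψ.Realize fun i => Sum.elim (fun b : B => (b : M)) x (t i)} := by
    refine Set.definable_iff_exists_formula_sum.2 ⟨ψ.relabel t, ?_⟩
    ext x
    exact (Formula.realize_relabel ..).symm
  exact ⟨χ, fun x => (Set.ext_iff.1 h x).symm⟩

theorem exists_formula_of_subset {B C : Set M} (h : B ⊆ C) (χ : L[[B]].Formula (Fin 1)) :
    ∃ χ' : L[[C]].Formula (Fin 1), ∀ x : Fin 1 → M, χ'.Realize x ↔ χ.Realize x := by
  obtain ⟨χ', h'⟩ := Set.Definable.mono (L := L) (s := Set.ofPred χ.Realize) ⟨χ, rfl⟩ h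
  exact ⟨χ', fun x => (Set.ext_iff.1 h' x).symm⟩

/-- Two tuples of length less than `κ` with the same type are conjugate. -/
theorem IsStronglyHomogeneous.exists_equiv {κ : Cardinal.{w}} (hhom : IsStronglyHomogeneous L κ M)
    {α : Type w} (hα : #α < κ) (x y : α → M)
    (h : ∀ ψ : L.Formula α, ψ.Realize x ↔ ψ.Realize y) :
    ∃ σ : M ≃[L] M, ∀ i, σ (x i) = y i := by
  choose g hg using fun b : Set.range x => b.2
  have hxy : ∀ {i k}, x i = x k → y i = y k := fun {i k} hik => by
    simpa [Formula.realize_equal, hik] using h ((Term.var i).equal (Term.var k))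
  obtain ⟨σ, hσ⟩ := hhom (Set.range x) (mk_range_le.trans_lt hα) (fun b => y (g b)) fun ψ => by
    have := h (ψ.relabel g)
    rw [Formula.realize_relabel, Formula.realize_relabel] at this
    rwa [show x ∘ g = fun b : Set.range x => (b : M) from funext hg] at this
  exact ⟨σ, fun i => (hσ ⟨x i, i, rfl⟩).trans (hxy (hg ⟨x i, i, rfl⟩))⟩

/-- A formula over an elementary substructure `S` with a solution has a solution in `S`. -/
theorem exists_mem_realize (S : L.ElementarySubstructure M) {a : M}
    (χ : L[[(S : Set M)]].Formula (Fin 1)) (ha : χ.Realize fun _ => a) :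
    ∃ m ∈ S, χ.Realize fun _ => m := by
  obtain ⟨φ, hφ⟩ := Set.definable_iff_exists_formula_sum.1
    (⟨χ, rfl⟩ : (S : Set M).Definable L (Set.ofPred χ.Realize))
  have hφ' : ∀ x : Fin 1 → M, χ.Realize x ↔ φ.Realize (Sum.elim (fun b : S => (b : M)) x) :=
    Set.ext_iff.1 hφ
  have h : (φ.iExs (Fin 1)).Realize (fun b : S => (b : M)) :=
    Formula.realize_iExs.2 ⟨_, (hφ' _).1 ha⟩
  obtain ⟨x, hx⟩ := Formula.realize_iExs.1
    ((S.subtype.map_formula (φ.iExs (Fin 1)) id).1 h)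
  refine ⟨x 0, (x 0).2, (hφ' _).2 ?_⟩
  convert (S.subtype.map_formula φ _).2 hx using 1
  ext (i | i)
  · rfl
  · rw [Subsingleton.elim i 0]
    rfl

/-- The type of `a` over an elementary substructure `S` is the trace of an ultrafilter which
contains `S`. -/
theorem exists_ultrafilter (S : L.ElementarySubstructure M) (a : M) :
    ∃ U : Ultrafilter M, (∀ᶠ m : M in U, m ∈ S) ∧ ∀ χ : L[[(S : Set M)]].Formula (Fin 1),
      χ.Realize (fun _ => a) ↔ ∀ᶠ m : M in U, χ.Realize fun _ => m := by
  let F : Filter M :=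
    { sets := {X | ∃ χ : L[[(S : Set M)]].Formula (Fin 1), χ.Realize (fun _ => a) ∧
        ∀ m ∈ S, χ.Realize (fun _ => m) → m ∈ X}
      univ_sets := ⟨⊤, by simp, fun _ _ _ => trivial⟩
      sets_of_superset := fun ⟨χ, hχ, h⟩ hXY => ⟨χ, hχ, fun m hm hr => hXY (h m hm hr)⟩
      inter_sets := fun ⟨χ, hχ, h⟩ ⟨χ', hχ', h'⟩ => ⟨χ ⊓ χ', Formula.realize_inf.2 ⟨hχ, hχ'⟩,
        fun m hm hr => ⟨h m hm (Formula.realize_inf.1 hr).1, h' m hm (Formula.realize_inf.1 hr).2⟩⟩ }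
  have hF : F.NeBot := ⟨fun hbot => by
    obtain ⟨χ, hχ, h⟩ : ∅ ∈ F := hbot ▸ Filter.mem_bot
    obtain ⟨m, hm, hr⟩ := exists_mem_realize S χ hχ
    exact h m hm hr⟩
  have hU : ∀ χ : L[[(S : Set M)]].Formula (Fin 1), χ.Realize (fun _ => a) →
      ∀ᶠ m : M in Ultrafilter.of F, χ.Realize fun _ => m := fun χ hχ =>
    Ultrafilter.of_le F ⟨χ, hχ, fun _ _ h => h⟩
  refine ⟨Ultrafilter.of F, Ultrafilter.of_le F ⟨⊤, by simp, fun _ h _ => h⟩, fun χ =>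
    ⟨hU χ, fun h => ?_⟩⟩
  by_contra hχ
  have h' := hU χ.not (Formula.realize_not.2 hχ)
  obtain ⟨m, hm, hm'⟩ := (h.and h').exists
  exact Formula.realize_not.1 hm' hm

/-- Elements with the same type over a small elementary substructure `S ⊇ A` are equivalent for
every `A`-invariant equivalence relation `E` with fewer than `κ` classes.

Let `a` and `b` have the same type `p` over `S`, and let `U` be an ultrafilter on `S` which
induces `p`. Choose in each class of `E` that contains realizations of `p` one of them, and let
`c` realize the type induced by `U` over `S`, `a`, `b` and these representatives. Then `c` is
equivalent to the chosen representative `d` of its own class. As `U` concentrates on `S`, the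
type of a pair `(x, c)` depends only on the type of `x` over `S`. Hence `(d, c)`, `(a, c)` and
`(b, c)` are conjugate over `A`, and both `a` and `b` are equivalent to `c`. -/
theorem typeSetoid_le {κ : Cardinal.{w}} (hκ : ℵ₀ ≤ κ) (hsat : IsSaturated L κ M)
    (hhom : IsStronglyHomogeneous L κ M) {A : Set M} (S : L.ElementarySubstructure M)
    (hAS : A ⊆ S) (hS : #S < κ) (E : Setoid M)
    (hE : ∀ σ : M ≃[L] M, (∀ a ∈ A, σ a = a) → ∀ x y, E x y → E (σ x) (σ y))
    (hEb : #(Quotient E) < κ) : typeSetoid L (S : Set M) ≤ E := by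
  intro a b hab
  obtain ⟨U, hUS, hU⟩ := exists_ultrafilter S a
  have hrep : ∀ q : Quotient E, ∃ d, typeSetoid L (S : Set M) d a ∧
      ∀ c, typeSetoid L (S : Set M) c a → (⟦c⟧ : Quotient E) = q → (⟦d⟧ : Quotient E) = q := by
    intro q
    by_cases h : ∃ d, typeSetoid L (S : Set M) d a ∧ (⟦d⟧ : Quotient E) = q
    · obtain ⟨d, hd, rfl⟩ := h
      exact ⟨d, hd, fun _ _ _ => rfl⟩
    · exact ⟨a, Setoid.refl' _ a, fun c hc hq => (h ⟨c, hc, hq⟩).elim⟩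
  choose rep hrep₁ hrep₂ using hrep
  let B : Set M := (S : Set M) ∪ (Set.range rep ∪ {a, b})
  have hSB : (S : Set M) ⊆ B := Set.subset_union_left
  have hB : #B < κ := by
    refine (mk_union_le _ _).trans_lt (add_lt_of_lt hκ hS ?_)
    refine (mk_union_le _ _).trans_lt (add_lt_of_lt hκ (mk_range_le.trans_lt hEb) ?_)
    exact (Set.toFinite {a, b}).lt_aleph0.trans_le hκ
  obtain ⟨c', hc'⟩ := hsat B hB {ψ | ∀ᶠ m : M in U, ψ.Realize fun _ => m} fun s hs => by
    obtain ⟨m, hm⟩ := ((Filter.eventually_all_finset s).2 fun ψ hψ => hs hψ).exists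
    exact ⟨_, hm⟩
  obtain ⟨c, rfl⟩ : ∃ c, c' = fun _ => c := ⟨c' 0, funext fun i => by rw [Subsingleton.elim i 0]⟩
  have hc : ∀ ψ : L[[B]].Formula (Fin 1),
      ψ.Realize (fun _ => c) ↔ ∀ᶠ m : M in U, ψ.Realize fun _ => m := by
    refine fun ψ => ⟨fun h => ?_, hc' ψ⟩
    by_contra h'
    have h'' : ∀ᶠ m : M in U, ψ.not.Realize fun _ => m := by
      simpa only [Formula.realize_not] using Ultrafilter.eventually_not.2 h'
    exact Formula.realize_not.1 (hc' _ h'') h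
  have hca : typeSetoid L (S : Set M) c a := typeSetoid_apply.2 fun χ => by
    obtain ⟨χ', h⟩ := exists_formula_of_subset hSB χ
    simp only [hU, ← h, hc]
  have key : ∀ d ∈ B, ∀ d' ∈ B, typeSetoid L (S : Set M) d d' →
      ∃ σ : M ≃[L] M, (∀ x ∈ A, σ x = x) ∧ σ d = d' ∧ σ c = c := by
    intro d hd d' hd' hdd
    have hrel : ∀ (ψ : L.Formula (A ⊕ Fin 2)), ∀ d ∈ B,
        ψ.Realize (Sum.elim (fun x : A => (x : M)) ![d, c]) ↔
          ∀ᶠ m : M in U, ψ.Realize (Sum.elim (fun x : A => (x : M)) ![d, m]) := by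
      intro ψ d hd
      obtain ⟨χ, hχ⟩ := exists_formula_realize_iff (B := B) ψ
        (Sum.elim (fun x => .inl ⟨x, hSB (hAS x.2)⟩) ![.inl ⟨d, hd⟩, .inr 0])
      have hχ' : ∀ m, χ.Realize (fun _ => m) ↔
          ψ.Realize (Sum.elim (fun x : A => (x : M)) ![d, m]) := fun m => by
        rw [hχ]
        refine iff_of_eq (congrArg _ (funext ?_))
        rintro (i | i)
        · rfl
        · fin_cases i <;> rfl
      simp only [← hχ', hc]
    obtain ⟨σ, hσ⟩ := hhom.exists_equiv (α := A ⊕ Fin 2)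
      (by
        rw [mk_sum, lift_uzero]
        refine add_lt_of_lt hκ ((mk_le_mk_of_subset hAS).trans_lt hS) ?_
        rw [mk_fin, lift_natCast]
        exact natCast_lt_aleph0.trans_le hκ)
      (Sum.elim (fun x : A => (x : M)) ![d, c]) (Sum.elim (fun x : A => (x : M)) ![d', c])
      fun ψ => by
        rw [hrel ψ d hd, hrel ψ d' hd']
        refine Filter.eventually_congr (hUS.mono fun m hm => ?_)
        obtain ⟨χ, hχ⟩ := exists_formula_realize_iff (B := (S : Set M)) ψ
          (Sum.elim (fun x => .inl ⟨x, hAS x.2⟩) ![.inr 0, .inl ⟨m, hm⟩])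
        have hχ' : ∀ d, χ.Realize (fun _ => d) ↔
            ψ.Realize (Sum.elim (fun x : A => (x : M)) ![d, m]) := fun d => by
          rw [hχ]
          refine iff_of_eq (congrArg _ (funext ?_))
          rintro (i | i)
          · rfl
          · fin_cases i <;> rfl
        rw [← hχ', ← hχ']
        exact typeSetoid_apply.1 hdd χ
    exact ⟨σ, fun x hx => hσ (.inl ⟨x, hx⟩), hσ (.inr 0), hσ (.inr 1)⟩
  have hdc : E (rep ⟦c⟧) c := Quotient.exact (hrep₂ ⟦c⟧ c hca rfl)
  have hEc : ∀ d' ∈ B, typeSetoid L (S : Set M) a d' → E d' c := by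
    intro d' hd' had
    obtain ⟨σ, hσA, hσd, hσc⟩ := key (rep ⟦c⟧) (.inr (.inl ⟨_, rfl⟩)) d' hd'
      (Setoid.trans' _ (hrep₁ _) had)
    simpa only [hσd, hσc] using hE σ hσA _ _ hdc
  exact Setoid.trans' _ (hEc a (.inr (.inr (.inl rfl))) (Setoid.refl' _ a))
    (Setoid.symm' _ (hEc b (.inr (.inr (.inr rfl))) hab))

theorem mk_quotient_typeSetoid_lt {κ : Cardinal.{w}} (hκ : κ.IsStrongLimit) (hκ' : ℵ₀ < κ)
    (hL : Cardinal.lift.{w} L.card < Cardinal.lift.{max u v} κ) {B : Set M} (hB : #B < κ) :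
    #(Quotient (typeSetoid L B)) < κ := by
  have hκ₁ : ℵ₀ < Cardinal.lift.{max u v} κ := by simpa using hκ'
  have hF : #(L[[B]].Formula (Fin 1)) < Cardinal.lift.{max u v} κ := by
    have h₁ : #(L[[B]].Formula (Fin 1)) ≤ #(Σ n, L[[B]].BoundedFormula (Fin 1) n) :=
      mk_le_of_injective (f := fun χ => ⟨0, χ⟩) fun _ _ h => by simpa using h
    refine (h₁.trans BoundedFormula.card_le).trans_lt (max_lt hκ₁ (add_lt_of_lt hκ₁.le ?_ ?_))
    · rw [mk_fin, lift_natCast]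
      exact natCast_lt_aleph0.trans hκ₁
    · rw [card_withConstants, lift_uzero]
      exact add_lt_of_lt hκ₁.le hL (lift_lt.2 hB)
  obtain ⟨ν, hνκ, hν⟩ := lt_lift_iff.1 hF
  have h : Cardinal.lift.{max u v} #(Quotient (typeSetoid L B)) ≤
      #(Set (L[[B]].Formula (Fin 1))) := by
    rw [← mk_uLift]
    exact mk_le_of_injective ((Setoid.kerLift_injective fun a : M =>
      {χ : L[[B]].Formula (Fin 1) | χ.Realize fun _ => a}).comp ULift.down_injective)
  rw [mk_set, ← hν, ← lift_two_power, lift_le] at h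
  exact h.trans_lt (hκ.isStrongPrelimit hνκ)

/-- There is an equivalence relation with fewer than `κ` classes which refines all `A`-invariant
equivalence relations with fewer than `κ` classes. -/
theorem exists_setoid_le {κ : Cardinal.{w}} (hκ : κ.IsStrongLimit)
    (hM : ℵ₀ < κ ∨ #M < κ)
    (hL : Cardinal.lift.{w} L.card < Cardinal.lift.{max u v} κ) (hsat : IsSaturated L κ M)
    (hhom : IsStronglyHomogeneous L κ M) {A : Set M} (hA : #A < κ) :
    ∃ e : Setoid M, #(Quotient e) < κ ∧ ∀ E : Setoid M,
      (∀ σ : M ≃[L] M, (∀ a ∈ A, σ a = a) → ∀ x y, E x y → E (σ x) (σ y)) →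
      #(Quotient E) < κ → e ≤ E := by
  by_cases hMκ : #M < κ
  · exact ⟨⊥, mk_quotient_le.trans_lt hMκ, fun _ _ _ => bot_le⟩
  have hκ' := hM.resolve_right hMκ
  obtain ⟨ν, hνκ, hν⟩ := lt_lift_iff.1 hL
  have hμ : max ℵ₀ (max #A ν) < κ := max_lt hκ' (max_lt hA hνκ)
  obtain ⟨S, hAS, hS⟩ := exists_elementarySubstructure_card_eq L A (max ℵ₀ (max #A ν))
    (le_max_left _ _) (by simp)
    (by rw [← hν]; exact lift_le.2 ((le_max_right _ _).trans (le_max_right _ _)))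
    (by simpa using (hμ.trans_le (not_lt.1 hMκ)).le)
  have hS' : #S < κ := by
    rw [lift_inj.1 hS]
    exact hμ
  exact ⟨typeSetoid L (S : Set M), mk_quotient_typeSetoid_lt hκ hκ' hL hS', fun E hE hEb =>
    typeSetoid_le hκ.aleph0_le hsat hhom S hAS hS' E hE hEb⟩

end Types

/-! ### Invariant and type-definable sets -/

section Invariance

variable {L : FirstOrder.Language.{u, v}} {M : Type w} [L.Structure M] {A : Set M}

theorem isInvariant_iff {X : Set M} : IsInvariant L A X ↔
    ∀ σ : M ≃[L] M, (∀ a ∈ A, σ a = a) → ∀ x, σ x ∈ X ↔ x ∈ X := by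
  refine ⟨fun h σ hσ x => ?_, fun h σ hσ => ?_⟩
  · nth_rewrite 1 [← h σ hσ]
    exact σ.injective.mem_set_image
  · ext y
    obtain ⟨x, rfl⟩ := σ.surjective y
    rw [σ.injective.mem_set_image, h σ hσ]

theorem isInvariant_sInter {C : Set (Set M)} (hC : ∀ Y ∈ C, IsInvariant L A Y) :
    IsInvariant L A (⋂₀ C) :=
  isInvariant_iff.2 fun σ hσ x =>
    forall₂_congr fun Y hY => isInvariant_iff.1 (hC Y hY) σ hσ x

theorem isTypeDefinable_sInter {C : Set (Set M)} (hC : ∀ Y ∈ C, IsTypeDefinable L A Y) :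
    IsTypeDefinable L A (⋂₀ C) := by
  choose! D hD hDY using hC
  refine ⟨⋃ Y ∈ C, D Y, ?_, ?_⟩
  · intro Z hZ
    obtain ⟨Y, hY, hZ⟩ := Set.mem_iUnion₂.1 hZ
    exact hD Y hY Z hZ
  · ext x
    simp only [Set.mem_sInter, Set.mem_iUnion]
    refine ⟨fun h Z ⟨Y, hY, hZ⟩ => ?_, fun h Y hY => ?_⟩
    · have := h Y hY
      rw [hDY Y hY] at this
      exact this Z hZ
    · rw [hDY Y hY]
      exact fun Z hZ => h Z ⟨Y, hY, hZ⟩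

theorem isInvariant_of_definable {Y : Set M} (hY : A.Definable₁ L Y) : IsInvariant L A Y := by
  obtain ⟨φ, hφ⟩ := Set.definable_iff_exists_formula_sum.1 hY
  have hφ' : ∀ x, x ∈ Y ↔ φ.Realize (Sum.elim (fun a : A => (a : M)) fun _ => x) :=
    fun x => Set.ext_iff.1 hφ fun _ => x
  refine isInvariant_iff.2 fun σ hσ x => ?_
  rw [hφ', hφ' x, ← StrongHomClass.realize_formula σ (v := Sum.elim _ fun _ => x), Sum.comp_elim,
    show σ ∘ (fun a : A => (a : M)) = fun a : A => (a : M) from funext fun a => hσ a a.2]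
  rfl

theorem IsTypeDefinable.isInvariant {X : Set M} (hX : IsTypeDefinable L A X) :
    IsInvariant L A X := by
  obtain ⟨D, hD, rfl⟩ := hX
  exact isInvariant_sInter fun Y hY => isInvariant_of_definable (hD Y hY)

end Invariance

section RingStructure

variable {L : FirstOrder.Language.{u, v}} (ι : FirstOrder.Language.ring →ᴸ L)
  {S : Type w} [Ring S] [FirstOrder.Ring.CompatibleRing S] [L.Structure S] [ι.IsExpansionOn S]
  {A : Set S}

include ι

theorem map_sub_of_equiv (σ : S ≃[L] S) (x y : S) : σ (x - y) = σ x - σ y := by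
  let t : FirstOrder.Language.ring.Term (Fin 2) := Term.var 0 + -Term.var 1
  have h : ∀ v : Fin 2 → S, (ι.onTerm t).realize v = v 0 - v 1 := fun v => by
    simp [t, sub_eq_add_neg]
  have := HomClass.realize_term (g := σ) (t := ι.onTerm t) (v := ![x, y])
  rw [h, h] at this
  exact this.symm

theorem map_mul_of_equiv (σ : S ≃[L] S) (x y : S) : σ (x * y) = σ x * σ y := by
  let t : FirstOrder.Language.ring.Term (Fin 2) := Term.var 0 * Term.var 1
  have h : ∀ v : Fin 2 → S, (ι.onTerm t).realize v = v 0 * v 1 := fun v => by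
    simp [t]
  have := HomClass.realize_term (g := σ) (t := ι.onTerm t) (v := ![x, y])
  rw [h, h] at this
  exact this.symm

theorem isInvariant_core {Y : Set S} (hY : IsInvariant L A Y) :
    IsInvariant L A {x | ∀ r s, r * x * s ∈ Y} := by
  refine isInvariant_iff.2 fun σ hσ x => ?_
  refine σ.surjective.forall₂.trans (forall₂_congr fun r s => ?_)
  rw [← map_mul_of_equiv ι, ← map_mul_of_equiv ι, isInvariant_iff.1 hY σ hσ]

theorem definable_core {Y : Set S} (hY : A.Definable₁ L Y) :
    A.Definable₁ L {x | ∀ r s, r * x * s ∈ Y} := by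
  obtain ⟨φ, hφ⟩ := Set.definable_iff_exists_formula_sum.1 hY
  have hφ' : ∀ x, x ∈ Y ↔ φ.Realize (Sum.elim (fun a : A => (a : S)) fun _ => x) :=
    fun x => Set.ext_iff.1 hφ fun _ => x
  let t : FirstOrder.Language.ring.Term ((A ⊕ Fin 1) ⊕ Fin 2) :=
    Term.var (.inr 0) * Term.var (.inl (.inr 0)) * Term.var (.inr 1)
  let ψ : L.Formula ((A ⊕ Fin 1) ⊕ Fin 2) :=
    BoundedFormula.subst φ (Sum.elim (fun a => Term.var (.inl (.inl a))) fun _ => ι.onTerm t)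
  have hψ : ∀ v : (A ⊕ Fin 1) ⊕ Fin 2 → S, ψ.Realize v ↔ φ.Realize
      (Sum.elim (fun a => v (.inl (.inl a)))
        fun _ => v (.inr 0) * v (.inl (.inr 0)) * v (.inr 1)) := fun v => by
    refine BoundedFormula.realize_subst.trans (iff_of_eq (congrArg₂ _ (funext ?_) rfl))
    rintro (i | i)
    · rfl
    · simp [t]
  refine Set.definable_iff_exists_formula_sum.2 ⟨ψ.iAlls (Fin 2), ?_⟩
  ext x
  refine Iff.trans ?_ Formula.realize_iAlls.symm
  simp only [Set.mem_ofPred_eq, hφ', hψ, Sum.elim_inl, Sum.elim_inr]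
  exact ⟨fun h i => h (i 0) (i 1), fun h r s => h ![r, s]⟩

/-- The core of an intersection of definable sets is the intersection of their cores, which are
definable by quantifying over the two factors. -/
theorem isTypeDefinable_core {Y : Set S} (hY : IsTypeDefinable L A Y) :
    IsTypeDefinable L A {x | ∀ r s, r * x * s ∈ Y} := by
  obtain ⟨D, hD, rfl⟩ := hY
  refine ⟨(fun Y : Set S => {x | ∀ r s, r * x * s ∈ Y}) '' D, ?_, ?_⟩
  · rintro _ ⟨Y, hY, rfl⟩
    exact definable_core ι (hD Y hY)
  · ext x
    simp only [Set.mem_ofPred_eq, Set.mem_sInter, Set.forall_mem_image]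
    exact ⟨fun h Y hY r s => h r s Y hY, fun h r s Y hY => h hY r s⟩

/-- The congruence modulo an invariant subgroup of bounded index is an invariant equivalence
relation, so `exists_setoid_le` applies to it. -/
theorem exists_setoid_sub_mem {κ : Cardinal.{w}} (hκ : κ.IsStrongLimit)
    (hS : ℵ₀ < κ ∨ #S < κ)
    (hL : Cardinal.lift.{w} L.card < Cardinal.lift.{max u v} κ) (hsat : IsSaturated L κ S)
    (hhom : IsStronglyHomogeneous L κ S) (hA : #A < κ) :
    ∃ e : Setoid S, #(Quotient e) < κ ∧ ∀ H : AddSubgroup S, IsInvariant L A (H : Set S) →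
      BoundedIndex κ H → ∀ a b, e a b → a - b ∈ H := by
  obtain ⟨e, he, h⟩ := exists_setoid_le hκ hS hL hsat hhom hA
  refine ⟨e, he, fun H hH hHb a b hab => ?_⟩
  have hrel : ∀ x y, QuotientAddGroup.leftRel H x y ↔ y - x ∈ H := fun x y => by
    rw [QuotientAddGroup.leftRel_apply, neg_add_eq_sub]
  refine (hrel b a).1 (h _ (fun σ hσ x y hxy => ?_) hHb (Setoid.symm' _ hab))
  rw [hrel] at hxy ⊢
  rw [← map_sub_of_equiv ι]
  exact (isInvariant_iff.1 hH σ hσ _).2 hxy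

end RingStructure

theorem finite_of_elementaryEmbedding {L : FirstOrder.Language.{u, v}} {M : Type w} {N : Type w'}
    [L.Structure M] [L.Structure N] (j : M ↪ₑ[L] N) [Finite M] : Finite N := by
  by_contra h
  have h' : N ⊨ Sentence.cardGe L (Nat.card M + 1) :=
    (Sentence.realize_cardGe L _).2 (natCast_le_aleph0.trans
      (aleph0_le_mk_iff.2 (not_finite_iff_infinite.1 h)))
  have := (Sentence.realize_cardGe L _).1 ((j.map_sentence _).2 h')
  rw [← Nat.cast_card, Nat.cast_le] at this
  omega

end RingComponents

theorem proposition2p3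
    {L : FirstOrder.Language.{u, v}} (ι : FirstOrder.Language.ring →ᴸ L)
    {R : Type w} [Ring R] [FirstOrder.Ring.CompatibleRing R] [L.Structure R]
    [ι.IsExpansionOn R]
    {Rbar : Type w'} [Ring Rbar] [FirstOrder.Ring.CompatibleRing Rbar] [L.Structure Rbar]
    [ι.IsExpansionOn Rbar]
    (j : R ↪ₑ[L] Rbar)
    (κ : Cardinal.{w'}) (hκ : κ.IsStrongLimit)
    (hR : Cardinal.lift.{w'} #R < Cardinal.lift.{w} κ)
    (hL : Cardinal.lift.{w'} L.card < Cardinal.lift.{max u v} κ)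
    (hsat : RingComponents.IsSaturated L κ Rbar)
    (hhom : RingComponents.IsStronglyHomogeneous L κ Rbar)
    (A : Set Rbar) (hA : #A < κ) :
    -- bounded index subgroups with a bounded index stabilizer contain bounded index ideals
    (∀ G : AddSubgroup Rbar, RingComponents.BoundedIndex κ G →
      (RingComponents.BoundedIndex κ (RingComponents.leftStabilizer G).toAddSubgroup ∨
        RingComponents.BoundedIndex κ (RingComponents.rightStabilizer G).toAddSubgroup) →
      (RingComponents.IsTypeDefinable L A (G : Set Rbar) →
        ∃ I : TwoSidedIdeal Rbar, (I : Set Rbar) ⊆ (G : Set Rbar) ∧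
          RingComponents.IsTypeDefinable L A (I : Set Rbar) ∧
          RingComponents.BoundedIndex κ (RingComponents.twoSidedAddSubgroup I)) ∧
      (RingComponents.IsInvariant L A (G : Set Rbar) →
        ∃ I : TwoSidedIdeal Rbar, (I : Set Rbar) ⊆ (G : Set Rbar) ∧
          RingComponents.IsInvariant L A (I : Set Rbar) ∧
          RingComponents.BoundedIndex κ (RingComponents.twoSidedAddSubgroup I))) ∧
    -- the smallest two-sided, left and right type-definable ideals exist and coincide
    (∃ (I : TwoSidedIdeal Rbar) (Il : Ideal Rbar) (Ir : Submodule Rbarᵐᵒᵖ Rbar),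
      IsLeast {J : TwoSidedIdeal Rbar | RingComponents.IsTypeDefinable L A (J : Set Rbar) ∧
        RingComponents.BoundedIndex κ (RingComponents.twoSidedAddSubgroup J)} I ∧
      IsLeast {J : Ideal Rbar | RingComponents.IsTypeDefinable L A (J : Set Rbar) ∧
        RingComponents.BoundedIndex κ J.toAddSubgroup} Il ∧
      IsLeast {J : Submodule Rbarᵐᵒᵖ Rbar |
        RingComponents.IsTypeDefinable L A (J : Set Rbar) ∧
        RingComponents.BoundedIndex κ J.toAddSubgroup} Ir ∧
      (Il : Set Rbar) = (I : Set Rbar) ∧ (Ir : Set Rbar) = (I : Set Rbar)) ∧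
    -- the smallest two-sided, left and right invariant ideals exist and coincide
    (∃ (I : TwoSidedIdeal Rbar) (Il : Ideal Rbar) (Ir : Submodule Rbarᵐᵒᵖ Rbar),
      IsLeast {J : TwoSidedIdeal Rbar | RingComponents.IsInvariant L A (J : Set Rbar) ∧
        RingComponents.BoundedIndex κ (RingComponents.twoSidedAddSubgroup J)} I ∧
      IsLeast {J : Ideal Rbar | RingComponents.IsInvariant L A (J : Set Rbar) ∧
        RingComponents.BoundedIndex κ J.toAddSubgroup} Il ∧
      IsLeast {J : Submodule Rbarᵐᵒᵖ Rbar |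
        RingComponents.IsInvariant L A (J : Set Rbar) ∧
        RingComponents.BoundedIndex κ J.toAddSubgroup} Ir ∧
      (Il : Set Rbar) = (I : Set Rbar) ∧ (Ir : Set Rbar) = (I : Set Rbar)) := by
  have hS : ℵ₀ < κ ∨ #Rbar < κ := by
    -- If `κ = ℵ₀` then `R` is finite, hence so is its elementary extension.
    rcases hκ.aleph0_le.lt_or_eq with h | rfl
    · exact Or.inl h
    · have : Finite R := by simpa [lt_aleph0_iff_finite] using hR
      have := RingComponents.finite_of_elementaryEmbedding j
      exact Or.inr (lt_aleph0_of_finite Rbar)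
  obtain ⟨e, he, heH⟩ := RingComponents.exists_setoid_sub_mem ι hκ hS hL hsat hhom hA
  refine ⟨fun G hG hst => ⟨fun hT => ?_, fun hI => ?_⟩, ?_, ?_⟩
  · refine ⟨RingComponents.twoSidedCore G, RingComponents.twoSidedCore_subset G, ?_,
      RingComponents.boundedIndex_twoSidedCore hκ hG hst⟩
    rw [RingComponents.coe_twoSidedCore]
    exact RingComponents.isTypeDefinable_core ι hT
  · refine ⟨RingComponents.twoSidedCore G, RingComponents.twoSidedCore_subset G, ?_,
      RingComponents.boundedIndex_twoSidedCore hκ hG hst⟩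
    rw [RingComponents.coe_twoSidedCore]
    exact RingComponents.isInvariant_core ι hI
  · exact RingComponents.exists_isLeast_ideals hκ _
      (fun _ => RingComponents.isTypeDefinable_sInter)
      (fun _ => RingComponents.isTypeDefinable_core ι) e he fun H hH => heH H hH.isInvariant
  · exact RingComponents.exists_isLeast_ideals hκ _
      (fun _ => RingComponents.isInvariant_sInter)
      (fun _ => RingComponents.isInvariant_core ι) e he heH
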